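/- Let $d\ge 1$ and $n\ge 1$ be integers and let $\gamma,\sigma>0$. For a Borel probability measure $Q$ on $\mathbb{R}$ with characteristic function $\varphi_Q$, define the Epps–Pulley statistic $$\mathrm{EP}_n(Q)=n\int_{\mathbb{R}}\bigl|\varphi_Q(\omega)-\varphi_{\mathcal N(0,\sigma^2)}(\omega)\bigr|^2\rho(\omega)\,d\omega,\qquad \rho(\omega)=\frac{1}{\sqrt{4\pi\gamma}}\,e^{-\omega^2/(4\gamma)},$$ where $\rho$ is the spectral density of the Gaussian kernel $e^{-\gamma(s-t)^2}$ on $\mathbb{R}$. For a Borel probability measure $P$ on $\mathbb{R}^d$, the SIGReg regularizer is $$\mathrm{SIGReg}(P)=\mathbb{E}_{\theta\sim\mathrm{Unif}(\mathbb S^{d-1})}\bigl[n^{-1}\,\mathrm{EP}_n(\theta^\top_{\#}P)\bigr],$$ where $\theta^\top_{\#}P$ is the law of $\theta^\top x$ for $x\sim P$. Let $$k(x,y)={}_1F_1\!\left(\tfrac12;\tfrac d2;-\gamma\|x-y\|_2^2\right),\qquad {}_1F_1(a;b;z)=\sum_{m\ge0}\frac{(a)_m}{(b)_m}\frac{z^m}{m!},$$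 be the Kummer confluent hypergeometric kernel on $\mathbb{R}^d$. Then: 1. $k$ is a positive definite kernel (that is, symmetric, with all quadratic forms $\sum_{i,j}c_ic_jk(x_i,x_j)$ nonnegative), so that it has a reproducing kernel Hilbert space. 2. For every Borel probability measure $P$ on $\mathbb{R}^d$, the integrals defining $\mathrm{SIGReg}(P)$ converge. If $\mathcal H$ is the reproducing kernel Hilbert space of $k$, the feature map $x\mapsto k(x,\cdot)\in\mathcal H$ is Bochner integrable with respect to $P$ and to $\mathcal N(0,\sigma^2I_d)$, and $$\mathrm{SIGReg}(P)=\mathrm{MMD}_k^2\bigl(P,\mathcal N(0,\sigma^2I_d)\bigr)=\bigl\|\mu_P-\mu_{\mathcal N(0,\sigma^2I_d)}\bigr\|_{\mathcal H}^2,\qquad \mu_Q=\int k(x,\cdot)\,dQ(x)\in\mathcal H .$$ 3. If $d\ge 2$, then $k$ has polynomially decaying tails: as $\|x-y\|_2\to\infty$, $$k(x,y)\sim\frac{\Gamma(d/2)}{\Gamma((d-1)/2)\,\sqrt{\gamma}}\;\|x-y\|_2^{-1},$$ where $\sim$ means that the ratio of the two sides tends to $1$. In contrast to this, for every $c>0$,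 as $\|x-y\|_2\to\infty$, the Gaussian kernel satisfies $e^{-\gamma\|x-y\|_2^2}=o\bigl(e^{-c\|x-y\|_2}\bigr)$, whereas $e^{-c\|x-y\|_2}=o\bigl(k(x,y)\bigr)$. -/

import Mathlib

open MeasureTheory ProbabilityTheory Filter Asymptotics
open scoped Topology

noncomputable section

namespace KerJEPA

/-- The Euclidean space `ℝ^d`. -/
abbrev E (d : ℕ) : Type := EuclideanSpace ℝ (Fin d)

/-! ### The SIGReg regularizer -/

/-- The spectral density of the univariate Gaussian kernel `exp (-γ (x - y)²)`, that is
`exp (-γ t²) = ∫ exp (i ω t) ρ(ω) dω`. -/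
def gaussianSpectralDensity (γ ω : ℝ) : ℝ :=
  1 / Real.sqrt (4 * Real.pi * γ) * Real.exp (-(1 / (4 * γ)) * ω ^ 2)

/-- The integrand `|φ_P(ω) - φ_{N(0,σ²)}(ω)|² ρ(ω)` of the Epps-Pulley functional. -/
def eppsPulleyIntegrand (γ σ : ℝ) (P : Measure ℝ) (ω : ℝ) : ℝ :=
  ‖charFun P ω - charFun (gaussianReal 0 (σ ^ 2).toNNReal) ω‖ ^ 2 * gaussianSpectralDensity γ ω

/-- The Epps-Pulley statistic with sample-size normalization `n`,
`n ∫ |φ_P(ω) - φ_{N(0,σ²)}(ω)|² ρ(ω) dω`. -/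
def eppsPulley (γ σ : ℝ) (n : ℕ) (P : Measure ℝ) : ℝ :=
  n * ∫ ω, eppsPulleyIntegrand γ σ P ω

/-- The uniform probability measure on the unit sphere `S^{d-1}` of `ℝ^d`: the normalized
surface measure. -/
def uniformSphere (d : ℕ) : Measure (Metric.sphere (0 : E d) 1) :=
  ((volume : Measure (E d)).toSphere Set.univ)⁻¹ • (volume : Measure (E d)).toSphere

/-- The law of `θᵀ x` for `x ∼ P`. -/
def projection {d : ℕ} (θ : E d) (P : Measure (E d)) : Measure ℝ :=
  P.map fun x => inner ℝ θ x

/-- The SIGReg regularizer: the normalized Epps-Pulley statistic of the univariate projections,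
averaged over uniformly random directions. -/
def sigReg (d : ℕ) (γ σ : ℝ) (n : ℕ) (P : Measure (E d)) : ℝ :=
  ∫ θ : Metric.sphere (0 : E d) 1,
    (n : ℝ)⁻¹ * eppsPulley γ σ n (projection (θ : E d) P) ∂(uniformSphere d)

/-- The isotropic Gaussian `N(0, σ² I_d)`. -/
def isotropicGaussian (d : ℕ) (σ : ℝ) : Measure (E d) :=
  multivariateGaussian 0 (σ ^ 2 • (1 : Matrix (Fin d) (Fin d) ℝ))

/-! ### Kernels -/

/-- The Kummer confluent hypergeometric function `₁F₁(a; b; z) = ∑ (a)_m / (b)_m z^m / m!`. -/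
def kummer (a b z : ℝ) : ℝ :=
  ∑' m : ℕ, (ascPochhammer ℝ m).eval a / (ascPochhammer ℝ m).eval b * (z ^ m / m.factorial)

/-- The kernel `₁F₁(1/2; d/2; -γ ‖x - y‖²)` on `ℝ^d`. -/
def kummerKernel (d : ℕ) (γ : ℝ) (x y : E d) : ℝ :=
  kummer (1 / 2) ((d : ℝ) / 2) (-γ * ‖x - y‖ ^ 2)

/-- The Gaussian kernel `exp (-γ ‖x - y‖²)` on `ℝ^d`. -/
def gaussianKernel (d : ℕ) (γ : ℝ) (x y : E d) : ℝ :=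
  Real.exp (-γ * ‖x - y‖ ^ 2)

/-- The filter on pairs `(x, y)` describing `‖x - y‖ → ∞`. -/
def farApart (d : ℕ) : Filter (E d × E d) :=
  comap (fun p => ‖p.1 - p.2‖) atTop

/-! ### Maximum mean discrepancy -/

/-- A real-valued kernel `k`, written as the operator-valued kernel `(x, y) ↦ k(x, y) • id` on the
one-dimensional space `ℝ`, the form in which `RKHS.kernel` is stated. Its being `PosSemidef` says
that `k` is a positive definite kernel. -/
def scalarKernel {X : Type*} (k : X → X → ℝ) : Matrix X X (ℝ →L[ℝ] ℝ) :=
  Matrix.of fun x y => k x y • ContinuousLinearMap.id ℝ ℝ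

section MMD

variable {X : Type*} (H : Type*) [NormedAddCommGroup H] [InnerProductSpace ℝ H]
  [CompleteSpace H] [RKHS ℝ H X ℝ]

/-- The canonical feature map `x ↦ k(x, ·)` of the reproducing kernel Hilbert space `H`. -/
def featureMap (x : X) : H := RKHS.kerFun H x 1

/-- The kernel mean embedding `μ_P = E_{x ∼ P}[k(x, ·)] ∈ H`. -/
def meanEmbedding [MeasurableSpace X] (P : Measure X) : H := ∫ x, featureMap H x ∂P

/-- The maximum mean discrepancy `‖μ_P - μ_Q‖_H`. -/
def mmd [MeasurableSpace X] (P Q : Measure X) : ℝ := ‖meanEmbedding H P - meanEmbedding H Q‖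

end MMD

end KerJEPA

end

namespace KerJEPA

/-! ### Moments of the uniform measure on the sphere -/

/-! The kernel is a sliced Gaussian kernel. The even moments of `⟨u, θ⟩` for uniform `θ` are
`(1/2)_m / (d/2)_m`, found by computing Gaussian moments both in Cartesian and in polar coordinates.
Summing the exponential series, the average of `exp (-γ ⟨θ, x - y⟩²)` over `θ` is the Kummer kernel.

Each such Gaussian is the characteristic function of `N(0, 2γ)`, whose density is `ρ`. Hence `k(x,
y)` is the characteristic function at `x - y` of `Λ`, the law of `ω • θ`
(`charFun_spectralMeasure`), and positive definiteness is the easy half of Bochner's theorem.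

Both sides of the identity equal `∫ |φ_P - φ_N|² dΛ`, where `N` is the isotropic Gaussian. For the
MMD this is Fubini after expanding the square (`mmd_sq_eq_integral_spectralMeasure`). For SIGReg,
the characteristic function of a projection is `φ_P` along a ray, and `N` projects to `N(0, σ²)` in
every direction (`sigReg_eq_integral_spectralMeasure`).

The tail comes from Euler's integral for `₁F₁(a; b; -t)`: as `t → ∞` only `s` near `0` contributes,
giving `t^(-a) Γ(b) / Γ(b - a)` (`tendsto_rpow_mul_kummer_neg`), used with `a = 1/2`, `t = γ r²`. -/

lemma integral_Ioi_pow_mul_exp_neg_sq (k : ℕ) :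
    ∫ r in Set.Ioi (0 : ℝ), r ^ k * Real.exp (-r ^ 2) = Real.Gamma (((k : ℝ) + 1) / 2) / 2 := by
  have h := integral_rpow_mul_exp_neg_rpow (p := 2) (q := k) two_pos
    (lt_of_lt_of_le (by norm_num) k.cast_nonneg)
  simp only [Real.rpow_natCast, Real.rpow_ofNat] at h
  rw [h]
  ring

lemma integral_pow_mul_exp_neg_sq (m : ℕ) :
    ∫ t : ℝ, t ^ (2 * m) * Real.exp (-t ^ 2) = Real.Gamma (m + 1 / 2) := by
  have h := integral_comp_abs (f := fun t : ℝ => t ^ (2 * m) * Real.exp (-t ^ 2))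
  simp only [sq_abs, pow_mul] at h
  simp only [pow_mul]
  rw [h]
  simp only [← pow_mul]
  rw [integral_Ioi_pow_mul_exp_neg_sq]
  push_cast
  ring_nf

/-- Gaussian moments in the direction of a unit vector. -/
lemma integral_inner_pow_mul_exp_neg_norm_sq {d : ℕ} (hd : 1 ≤ d) (u : E d) (hu : ‖u‖ = 1)
    (m : ℕ) :
    ∫ x : E d, inner ℝ u x ^ (2 * m) * Real.exp (-‖x‖ ^ 2) =
      Real.Gamma (m + 1 / 2) * Real.Gamma (1 / 2) ^ (d - 1) := by
  let i₀ : Fin d := ⟨0, hd⟩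
  -- Extending `u` to an orthonormal basis and rotating makes `⟨u, x⟩` a coordinate, so that the
  -- integral factors into one-dimensional ones.
  have hv : Orthonormal ℝ (({i₀} : Set (Fin d)).domRestrict fun _ => u) :=
    ⟨fun _ => hu, fun i j hij => (hij (Subsingleton.elim i j)).elim⟩
  obtain ⟨b, hb⟩ := hv.exists_orthonormalBasis_extension_of_card_eq (by simp)
  have hb0 : b i₀ = u := hb i₀ rfl
  have h1 := b.measurePreserving_repr.integral_comp b.repr.toHomeomorph.measurableEmbedding
    (fun y : E d => y i₀ ^ (2 * m) * Real.exp (-‖y‖ ^ 2))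
  have h2 := (PiLp.volume_preserving_ofLp (Fin d)).integral_comp
    (MeasurableEquiv.toLp 2 (Fin d → ℝ)).symm.measurableEmbedding
    (fun y : Fin d → ℝ => ∏ i, y i ^ (if i = i₀ then 2 * m else 0) * Real.exp (-y i ^ 2))
  have h3 (y : E d) : y i₀ ^ (2 * m) * Real.exp (-‖y‖ ^ 2) =
      ∏ i, y.ofLp i ^ (if i = i₀ then 2 * m else 0) * Real.exp (-y i ^ 2) := by
    rw [Finset.prod_mul_distrib, ← Real.exp_sum, EuclideanSpace.norm_sq_eq]
    simp [Finset.prod_ite_eq', apply_ite]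
  simp only [LinearIsometryEquiv.norm_map, b.repr_apply_apply, hb0] at h1
  rw [h1]
  simp only [h3]
  rw [h2, integral_fintype_prod_volume_eq_prod
    (f := fun i (t : ℝ) => t ^ (if i = i₀ then 2 * m else 0) * Real.exp (-t ^ 2)),
    ← Finset.mul_prod_erase _ _ (Finset.mem_univ i₀)]
  congr 1
  · simpa using integral_pow_mul_exp_neg_sq m
  · rw [Finset.prod_congr rfl (g := fun _ => Real.Gamma (1 / 2))]
    · simp
    · intro i hi
      simpa [(Finset.ne_of_mem_erase hi)] using integral_pow_mul_exp_neg_sq 0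

/-- Integration in polar coordinates of a product of an angular and a radial function. -/
lemma integral_polar_mul {d : ℕ} (hd : 1 ≤ d) (F : E d → ℝ) (g : E d → ℝ) (h : ℝ → ℝ)
    (hF : ∀ (θ : E d) (r : ℝ), ‖θ‖ = 1 → 0 < r → F (r • θ) = g θ * h r) :
    ∫ x, F x = (∫ θ : Metric.sphere (0 : E d) 1, g θ ∂(volume : Measure (E d)).toSphere) *
      ∫ r in Set.Ioi (0 : ℝ), r ^ (d - 1) * h r := by
  have : Nontrivial (E d) := by
    have : Nonempty (Fin d) := ⟨⟨0, hd⟩⟩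
    infer_instance
  have h1 := (volume : Measure (E d)).measurePreserving_homeomorphUnitSphereProd.integral_comp
    (Homeomorph.measurableEmbedding _)
    (fun p : Metric.sphere (0 : E d) 1 × Set.Ioi (0 : ℝ) => g p.1 * h p.2)
  rw [integral_prod_mul (fun θ : Metric.sphere (0 : E d) 1 => g θ)
    (fun r : Set.Ioi (0 : ℝ) => h r)] at h1
  have h2 : ∫ x, F x = ∫ x : ({0}ᶜ : Set (E d)), F x ∂(volume.comap Subtype.val) := by
    rw [integral_subtype_comap (measurableSet_singleton _).compl F, restrict_compl_singleton]
  have h3 : ∫ r : Set.Ioi (0 : ℝ), h r ∂(Measure.volumeIoiPow (d - 1)) =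
      ∫ r in Set.Ioi (0 : ℝ), r ^ (d - 1) * h r := by
    simp only [Measure.volumeIoiPow, ENNReal.ofReal]
    rw [integral_withDensity_eq_integral_smul,
      integral_subtype_comap measurableSet_Ioi fun a ↦ Real.toNNReal (a ^ (d - 1)) • h a,
      setIntegral_congr_fun measurableSet_Ioi fun x hx ↦ ?_]
    · rw [NNReal.smul_def, Real.coe_toNNReal _ (pow_nonneg hx.out.le _), smul_eq_mul]
    · exact (measurable_subtype_coe.pow_const _).real_toNNReal
  rw [h2, ← h3]
  simp only [finrank_euclideanSpace, Fintype.card_fin] at h1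
  rw [← h1]
  refine integral_congr_ae (ae_of_all _ fun x => ?_)
  have hx : 0 < ‖(x : E d)‖ := norm_pos_iff.2 x.2
  have h4 := hF (‖(x : E d)‖⁻¹ • (x : E d)) ‖(x : E d)‖
    (by rw [norm_smul, norm_inv, norm_norm, inv_mul_cancel₀ hx.ne']) hx
  rw [smul_inv_smul₀ hx.ne'] at h4
  simpa using h4

instance isProbabilityMeasure_uniformSphere (d : ℕ) [NeZero d] :
    IsProbabilityMeasure (uniformSphere d) := by
  refine ⟨?_⟩
  have : Nonempty (Fin d) := ⟨0⟩
  have h : (volume : Measure (E d)).toSphere Set.univ ≠ 0 := by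
    simp [Measure.measure_univ_eq_zero, -Measure.toSphere_apply_univ]
  simp only [uniformSphere, Measure.smul_apply, smul_eq_mul]
  exact ENNReal.inv_mul_cancel h (measure_ne_top _ _)

lemma Gamma_add_natCast {a : ℝ} (ha : 0 < a) (m : ℕ) :
    Real.Gamma (a + m) = (ascPochhammer ℝ m).eval a * Real.Gamma a := by
  induction m with
  | zero => simp
  | succ m ih =>
    rw [ascPochhammer_succ_eval, Nat.cast_succ, ← add_assoc, Real.Gamma_add_one (by positivity), ih]
    ring

/-- In polar coordinates the Gaussian moment splits into the spherical moment and a radial Gamma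
integral. -/
lemma integral_toSphere_inner_pow {d : ℕ} (hd : 1 ≤ d) (u : E d) (hu : ‖u‖ = 1) (m : ℕ) :
    (∫ θ : Metric.sphere (0 : E d) 1, inner ℝ u (θ : E d) ^ (2 * m)
        ∂(volume : Measure (E d)).toSphere) * (Real.Gamma (d / 2 + m) / 2) =
      Real.Gamma (m + 1 / 2) * Real.Gamma (1 / 2) ^ (d - 1) := by
  rw [← integral_inner_pow_mul_exp_neg_norm_sq hd u hu m]
  have h : (d : ℝ) / 2 + m = ((d - 1 + 2 * m : ℕ) + 1) / 2 := by
    push_cast [Nat.cast_sub hd]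
    ring
  rw [h, ← integral_Ioi_pow_mul_exp_neg_sq, integral_polar_mul hd _
    (fun θ => inner ℝ u θ ^ (2 * m)) (fun r => r ^ (2 * m) * Real.exp (-r ^ 2) )]
  · simp only [pow_add, mul_assoc]
  · intro θ r hθ _
    rw [inner_smul_right, norm_smul, hθ, mul_one, Real.norm_eq_abs, sq_abs, mul_pow]
    ring

/-- The moments of a coordinate of a uniformly distributed point of the sphere. -/
lemma integral_uniformSphere_inner_pow {d : ℕ} (hd : 1 ≤ d) (u : E d) (hu : ‖u‖ = 1) (m : ℕ) :
    ∫ θ : Metric.sphere (0 : E d) 1, inner ℝ u (θ : E d) ^ (2 * m) ∂(uniformSphere d) =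
      (ascPochhammer ℝ m).eval (1 / 2) / (ascPochhammer ℝ m).eval ((d : ℝ) / 2) := by
  have hd' : 0 < (d : ℝ) / 2 := by positivity
  -- The case `m = 0` gives the total surface mass, which serves as the normalization.
  have h0 := integral_toSphere_inner_pow hd u hu 0
  have hm := integral_toSphere_inner_pow hd u hu m
  have hG := Real.Gamma_pos_of_pos hd'
  have hG2 := Real.Gamma_pos_of_pos (one_half_pos (α := ℝ))
  have hP := ascPochhammer_pos m _ hd'
  rw [Gamma_add_natCast hd', add_comm, Gamma_add_natCast one_half_pos] at hm
  simp only [mul_zero, pow_zero, Nat.cast_zero, add_zero, zero_add, integral_const,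
    smul_eq_mul, mul_one] at h0
  rw [uniformSphere, integral_smul_measure, ENNReal.toReal_inv, smul_eq_mul, ← Measure.real]
  generalize ∫ θ : Metric.sphere (0 : E d) 1, inner ℝ u (θ : E d) ^ (2 * m)
        ∂(volume : Measure (E d)).toSphere = I at *
  generalize (volume : Measure (E d)).toSphere.real Set.univ = A at *
  have hA : A ≠ 0 := by
    rintro rfl
    rw [zero_mul] at h0
    have : 0 < Real.Gamma (1 / 2) * Real.Gamma (1 / 2) ^ (d - 1) := by positivity
    exact this.ne h0
  field_simp
  refine mul_right_cancel₀ (b := Real.Gamma (d / 2) / 2) (by positivity) ?_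
  linear_combination hm - (ascPochhammer ℝ m).eval (1 / 2) * h0

/-! ### The spectral measure of the Kummer kernel -/

/-- The Kummer function with parameters `1/2` and `d/2` as a spherical average. -/
lemma integral_uniformSphere_exp_mul_inner_sq {d : ℕ} (hd : 1 ≤ d) (u : E d) (hu : ‖u‖ = 1)
    (s : ℝ) :
    ∫ θ : Metric.sphere (0 : E d) 1, Real.exp (s * inner ℝ u (θ : E d) ^ 2) ∂(uniformSphere d) =
      kummer (1 / 2) ((d : ℝ) / 2) s := by
  have : NeZero d := ⟨by omega⟩
  have hle (θ : Metric.sphere (0 : E d) 1) : |inner ℝ u (θ : E d)| ≤ 1 := by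
    simpa [hu] using abs_real_inner_le_norm u (θ : E d)
  have h := hasSum_integral_of_dominated_convergence (μ := uniformSphere d)
    (F := fun (m : ℕ) (θ : Metric.sphere (0 : E d) 1) =>
      s ^ m / m.factorial * inner ℝ u (θ : E d) ^ (2 * m))
    (f := fun θ => Real.exp (s * inner ℝ u (θ : E d) ^ 2))
    (fun m _ => |s| ^ m / m.factorial)
    (fun m => (Continuous.aestronglyMeasurable (by fun_prop)))
    (fun m => ae_of_all _ fun θ => by
      rw [norm_mul, norm_div, norm_pow, norm_pow, Real.norm_natCast, Real.norm_eq_abs,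
        Real.norm_eq_abs]
      exact mul_le_of_le_one_right (by positivity) (pow_le_one₀ (abs_nonneg _) (hle θ)))
    (ae_of_all _ fun _ => Real.summable_pow_div_factorial _)
    (integrable_const _)
    (ae_of_all _ fun θ => by
      have := NormedSpace.expSeries_div_hasSum_exp (s * inner ℝ u (θ : E d) ^ 2)
      rw [← Real.exp_eq_exp_ℝ] at this
      convert! this using 2 with m
      rw [mul_pow, pow_mul]
      ring)
  rw [← h.tsum_eq, kummer]
  refine tsum_congr fun m => ?_
  rw [integral_const_mul, integral_uniformSphere_inner_pow hd u hu]
  ring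

lemma integral_uniformSphere_exp_neg_inner_sq {d : ℕ} (hd : 1 ≤ d) (γ : ℝ) (x y : E d) :
    ∫ θ : Metric.sphere (0 : E d) 1, Real.exp (-γ * inner ℝ (θ : E d) (x - y) ^ 2)
      ∂(uniformSphere d) = kummerKernel d γ x y := by
  have : Nonempty (Fin d) := ⟨⟨0, hd⟩⟩
  obtain ⟨u, hu, hz⟩ : ∃ u : E d, ‖u‖ = 1 ∧ x - y = ‖x - y‖ • u := by
    rcases eq_or_ne (x - y) 0 with h | h
    -- For `x = y` there is no direction to normalize, and any unit vector serves.
    · obtain ⟨u, hu⟩ := exists_norm_eq (E d) zero_le_one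
      exact ⟨u, hu, by simp [h]⟩
    · have := norm_ne_zero_iff.2 h
      refine ⟨‖x - y‖⁻¹ • (x - y), ?_, by rw [smul_inv_smul₀ this]⟩
      rw [norm_smul, norm_inv, norm_norm, inv_mul_cancel₀ this]
  rw [kummerKernel, ← integral_uniformSphere_exp_mul_inner_sq hd u hu]
  refine integral_congr_ae (ae_of_all _ fun θ => ?_)
  simp only
  rw [hz, inner_smul_right, real_inner_comm u, mul_pow, norm_smul, norm_norm, hu]
  ring_nf

lemma gaussianPDFReal_eq_gaussianSpectralDensity {γ : ℝ} (hγ : 0 < γ) (ω : ℝ) :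
    gaussianPDFReal 0 (2 * γ).toNNReal ω = gaussianSpectralDensity γ ω := by
  rw [gaussianPDFReal, gaussianSpectralDensity, Real.coe_toNNReal _ (by positivity), one_div]
  congr 3 <;> ring

/-- The spectral measure of the Kummer kernel: the law of `ω • θ` for independent
`θ ∼ Unif(S^{d-1})` and `ω ∼ N(0, 2γ)`. -/
noncomputable def spectralMeasure (d : ℕ) (γ : ℝ) : Measure (E d) :=
  ((uniformSphere d).prod (gaussianReal 0 (2 * γ).toNNReal)).map fun p => p.2 • (p.1 : E d)

lemma measurable_smul_sphere (d : ℕ) :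
    Measurable fun p : Metric.sphere (0 : E d) 1 × ℝ => p.2 • (p.1 : E d) := by
  fun_prop

instance isProbabilityMeasure_spectralMeasure (d : ℕ) [NeZero d] (γ : ℝ) :
    IsProbabilityMeasure (spectralMeasure d γ) :=
  Measure.isProbabilityMeasure_map (measurable_smul_sphere d).aemeasurable

/-- Integrating over `ω` first gives `exp (-γ ⟨θ, x - y⟩²)`, whose spherical average is the kernel.
-/
lemma charFun_spectralMeasure {d : ℕ} (hd : 1 ≤ d) {γ : ℝ} (hγ : 0 < γ) (x y : E d) :
    charFun (spectralMeasure d γ) (x - y) = kummerKernel d γ x y := by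
  have : NeZero d := ⟨by omega⟩
  rw [charFun_apply, spectralMeasure, integral_map (measurable_smul_sphere d).aemeasurable
    (Continuous.aestronglyMeasurable (by fun_prop)), integral_prod,
    ← integral_uniformSphere_exp_neg_inner_sq hd, ← integral_complex_ofReal]
  · refine integral_congr_ae (ae_of_all _ fun θ => ?_)
    have h := charFun_gaussianReal (μ := 0) (v := (2 * γ).toNNReal) (inner ℝ (θ : E d) (x - y))
    rw [charFun_apply_real] at h
    simp only [inner_smul_left, conj_trivial]
    convert! h using 1
    · refine integral_congr_ae (ae_of_all _ fun ω => ?_)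
      push_cast
      ring_nf
    · rw [Real.coe_toNNReal']
      push_cast [max_eq_left (by positivity : 0 ≤ 2 * γ)]
      ring_nf
  · refine Integrable.of_bound (C := 1) (Continuous.aestronglyMeasurable (by fun_prop))
      (ae_of_all _ fun p => ?_)
    rw [Complex.norm_exp_ofReal_mul_I]

lemma integral_cos_spectralMeasure {d : ℕ} (hd : 1 ≤ d) {γ : ℝ} (hγ : 0 < γ) (x y : E d) :
    ∫ v, Real.cos (inner ℝ v (x - y)) ∂(spectralMeasure d γ) = kummerKernel d γ x y := by
  have : NeZero d := ⟨by omega⟩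
  rw [← Complex.ofReal_re (kummerKernel d γ x y), ← charFun_spectralMeasure hd hγ, charFun_apply,
    ← RCLike.re_eq_complex_re, ← integral_re]
  · simp [Complex.exp_ofReal_mul_I_re]
  · refine Integrable.of_bound (C := 1) (Continuous.aestronglyMeasurable (by fun_prop))
      (ae_of_all _ fun p => ?_)
    rw [Complex.norm_exp_ofReal_mul_I]

/-! ### Positive definiteness -/

theorem posSemidef_scalarKernel_kummerKernel {d : ℕ} (hd : 1 ≤ d) {γ : ℝ} (hγ : 0 < γ) :
    (scalarKernel (kummerKernel d γ)).PosSemidef := by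
  have : NeZero d := ⟨by omega⟩
  have tfae := RKHS.posSemidef_tfae (K := scalarKernel (kummerKernel d γ))
  refine (tfae.out 0 2 rfl rfl).2 ⟨?_, fun w => ?_⟩
  · ext x y
    have hid : star (ContinuousLinearMap.id ℝ ℝ) = ContinuousLinearMap.id ℝ ℝ := star_one (ℝ →L[ℝ] ℝ)
    simp [scalarKernel, kummerKernel, norm_sub_rev x y, hid]
  · have hint (x y : E d) (c c' : ℝ) : Integrable (fun v => c * Real.cos (inner ℝ v (x - y)) * c')
        (spectralMeasure d γ) :=
      ((Integrable.of_bound (C := 1) (Continuous.aestronglyMeasurable (by fun_prop))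
        (ae_of_all _ fun v => by simpa using Real.abs_cos_le_one _)).const_mul _).mul_const _
    -- Since `cos (a - b) = cos a cos b + sin a sin b`, the quadratic form is a spectral average of
    -- sums of two squares.
    have key : RCLike.re (w.sum fun x c => w.sum fun y c' =>
        inner ℝ (scalarKernel (kummerKernel d γ) y x c) c') =
        ∫ v, (∑ x ∈ w.support, w x * Real.cos (inner ℝ v x)) ^ 2 +
          (∑ x ∈ w.support, w x * Real.sin (inner ℝ v x)) ^ 2 ∂(spectralMeasure d γ) := by
      calc _ = ∑ x ∈ w.support, ∑ y ∈ w.support,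
            ∫ v, w y * Real.cos (inner ℝ v (y - x)) * w x ∂(spectralMeasure d γ) := by
            simp only [integral_const_mul, integral_mul_const,
              integral_cos_spectralMeasure hd hγ]
            simp [Finsupp.sum, scalarKernel]
            refine Finset.sum_congr rfl fun _ _ => Finset.sum_congr rfl fun _ _ => by ring
        _ = ∫ v, ∑ x ∈ w.support, ∑ y ∈ w.support,
            w y * Real.cos (inner ℝ v (y - x)) * w x ∂(spectralMeasure d γ) := by
            rw [integral_finsetSum _ fun x _ => integrable_finsetSum _ fun y _ => hint _ _ _ _]
            exact Finset.sum_congr rfl fun x _ =>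
              (integral_finsetSum _ fun y _ => hint _ _ _ _).symm
        _ = _ := by
            refine integral_congr_ae (ae_of_all _ fun v => ?_)
            simp only [sq, Finset.sum_mul_sum, inner_sub_right, Real.cos_sub]
            rw [← Finset.sum_add_distrib]
            refine Finset.sum_congr rfl fun _ _ => ?_
            rw [← Finset.sum_add_distrib]
            refine Finset.sum_congr rfl fun _ _ => by ring
    rw [key]
    exact integral_nonneg fun v => by positivity

/-! ### The maximum mean discrepancy of the Kummer kernel -/

open scoped ComplexConjugate in
/-- The average of a kernel over `P ⊗ Q`, in terms of its spectral measure `Λ`. -/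
lemma integral_prod_charFun_sub {d : ℕ} (Λ P Q : Measure (E d)) [IsProbabilityMeasure Λ]
    [IsProbabilityMeasure P] [IsProbabilityMeasure Q] :
    ∫ p : E d × E d, charFun Λ (p.1 - p.2) ∂(P.prod Q) =
      ∫ v, charFun P v * conj (charFun Q v) ∂Λ := by
  simp only [charFun_apply (μ := Λ)]
  rw [integral_integral_swap]
  · refine integral_congr_ae (ae_of_all _ fun v => ?_)
    simp only [charFun_apply]
    rw [← integral_conj, ← integral_prod_mul]
    refine integral_congr_ae (ae_of_all _ fun p => ?_)
    simp only [← Complex.exp_conj, ← Complex.exp_add, inner_sub_right, real_inner_comm v]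
    simp only [map_mul, Complex.conj_I, Complex.conj_ofReal]
    push_cast
    ring_nf
  · refine Integrable.of_bound (C := 1) (Continuous.aestronglyMeasurable (by fun_prop))
      (ae_of_all _ fun p => ?_)
    rw [Function.uncurry, Complex.norm_exp_ofReal_mul_I]

section FeatureMap

variable {d : ℕ} {γ : ℝ} {H : Type*} [NormedAddCommGroup H] [InnerProductSpace ℝ H]
  [CompleteSpace H] [RKHS ℝ H (E d) ℝ]

lemma inner_featureMap {X : Type*} {H : Type*} [NormedAddCommGroup H] [InnerProductSpace ℝ H]
    [CompleteSpace H] [RKHS ℝ H X ℝ] {k : X → X → ℝ} (hH : RKHS.kernel H = scalarKernel k)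
    (x y : X) : inner ℝ (featureMap H x) (featureMap H y) = k y x := by
  rw [featureMap, featureMap, ← RKHS.kernel_inner, hH]
  simp [scalarKernel]

lemma norm_featureMap (hd : 1 ≤ d) (hγ : 0 < γ)
    (hH : RKHS.kernel H = scalarKernel (kummerKernel d γ)) (x : E d) : ‖featureMap H x‖ = 1 := by
  have : NeZero d := ⟨by omega⟩
  have h := inner_featureMap hH x x
  rw [← integral_cos_spectralMeasure hd hγ, real_inner_self_eq_norm_sq] at h
  exact (pow_eq_one_iff_of_nonneg (norm_nonneg _) two_ne_zero).1 (by simpa using h)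

lemma continuous_kummerKernel (hd : 1 ≤ d) (hγ : 0 < γ) :
    Continuous fun p : E d × E d => kummerKernel d γ p.1 p.2 := by
  have : NeZero d := ⟨by omega⟩
  simp_rw [← integral_cos_spectralMeasure hd hγ]
  refine continuous_of_dominated (bound := fun _ => 1)
    (fun _ => Continuous.aestronglyMeasurable (by fun_prop))
    (fun _ => ae_of_all _ fun _ => Real.abs_cos_le_one _) (integrable_const _)
    (ae_of_all _ fun _ => by fun_prop)

/-- Because `k(x, x) = 1`, feature distances satisfy `‖Φ y - Φ x‖² = 2 - 2 k(x, y)`, so continuity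
passes from `k` to `Φ`. With unit norm, this yields Bochner integrability without assuming `H`
separable. -/
lemma continuous_featureMap (hd : 1 ≤ d) (hγ : 0 < γ)
    (hH : RKHS.kernel H = scalarKernel (kummerKernel d γ)) : Continuous (featureMap H) := by
  refine continuous_iff_continuousAt.2 fun x => ?_
  rw [ContinuousAt, tendsto_iff_norm_sub_tendsto_zero]
  have hk (y : E d) : ‖featureMap H y - featureMap H x‖ = √(2 - 2 * kummerKernel d γ x y) := by
    rw [← Real.sqrt_sq (norm_nonneg _), norm_sub_sq_real, inner_featureMap hH,
      norm_featureMap hd hγ hH, norm_featureMap hd hγ hH]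
    ring_nf
  have hx : √(2 - 2 * kummerKernel d γ x x) = 0 := by rw [← hk]; simp
  simp_rw [hk]
  rw [← hx]
  have := (continuous_kummerKernel hd hγ).comp (Continuous.prodMk_right x)
  exact Continuous.tendsto (by fun_prop) x

lemma integrable_featureMap (hd : 1 ≤ d) (hγ : 0 < γ)
    (hH : RKHS.kernel H = scalarKernel (kummerKernel d γ)) (P : Measure (E d))
    [IsProbabilityMeasure P] : Integrable (featureMap H) P :=
  Integrable.of_bound (C := 1) (continuous_featureMap hd hγ hH).aestronglyMeasurable
    (ae_of_all _ fun x => (norm_featureMap hd hγ hH x).le)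

open scoped ComplexConjugate in
-- The inner product passes through both Bochner integrals, leaving the double average of `k`, which
-- Fubini moves to the spectral side.
lemma inner_meanEmbedding (hd : 1 ≤ d) (hγ : 0 < γ)
    (hH : RKHS.kernel H = scalarKernel (kummerKernel d γ)) (P Q : Measure (E d))
    [IsProbabilityMeasure P] [IsProbabilityMeasure Q] :
    ((inner ℝ (meanEmbedding H P) (meanEmbedding H Q) : ℝ) : ℂ) =
      ∫ v, charFun Q v * conj (charFun P v) ∂(spectralMeasure d γ) := by
  have : NeZero d := ⟨by omega⟩
  rw [← integral_prod_charFun_sub]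
  simp_rw [charFun_spectralMeasure hd hγ]
  rw [integral_complex_ofReal, integral_prod_symm, meanEmbedding, meanEmbedding,
    real_inner_comm, ← integral_inner (integrable_featureMap hd hγ hH P)]
  · congr 1
    refine integral_congr_ae (ae_of_all _ fun x => ?_)
    simp only
    rw [real_inner_comm, ← integral_inner (integrable_featureMap hd hγ hH Q)]
    simp only [inner_featureMap hH]
  · refine Integrable.of_bound (C := 1) (continuous_kummerKernel hd hγ).aestronglyMeasurable
      (ae_of_all _ fun p => ?_)
    rw [← inner_featureMap hH]
    simpa [norm_featureMap hd hγ hH] using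
      abs_real_inner_le_norm (featureMap H p.2) (featureMap H p.1)

lemma integrable_charFun_mul_conj {d : ℕ} (Λ P Q : Measure (E d)) [IsProbabilityMeasure Λ]
    [IsProbabilityMeasure P] [IsProbabilityMeasure Q] :
    Integrable (fun v => charFun P v * (starRingEnd ℂ) (charFun Q v)) Λ := by
  refine Integrable.of_bound (C := 1) ?_ (ae_of_all _ fun v => ?_)
  · exact (measurable_charFun.mul
      (Complex.continuous_conj.measurable.comp measurable_charFun)).aestronglyMeasurable
  · rw [norm_mul, RCLike.norm_conj]
    exact mul_le_one₀ (norm_charFun_le_one v) (norm_nonneg _) (norm_charFun_le_one v)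

/-- The squared maximum mean discrepancy is the spectral `L²` distance of the characteristic
functions. -/
theorem mmd_sq_eq_integral_spectralMeasure (hd : 1 ≤ d) (hγ : 0 < γ)
    (hH : RKHS.kernel H = scalarKernel (kummerKernel d γ)) (P Q : Measure (E d))
    [IsProbabilityMeasure P] [IsProbabilityMeasure Q] :
    mmd H P Q ^ 2 = ∫ v, ‖charFun P v - charFun Q v‖ ^ 2 ∂(spectralMeasure d γ) := by
  have : NeZero d := ⟨by omega⟩
  apply Complex.ofReal_injective
  rw [mmd, ← real_inner_self_eq_norm_sq, inner_sub_left, inner_sub_right, inner_sub_right,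
    ← integral_complex_ofReal]
  push_cast
  simp only [inner_meanEmbedding hd hγ hH]
  rw [← integral_sub (integrable_charFun_mul_conj _ _ _) (integrable_charFun_mul_conj _ _ _),
    ← integral_sub (integrable_charFun_mul_conj _ _ _) (integrable_charFun_mul_conj _ _ _),
    ← integral_sub]
  · refine integral_congr_ae (ae_of_all _ fun v => ?_)
    simp only [← Complex.mul_conj', map_sub]
    ring
  · exact (integrable_charFun_mul_conj _ _ _).sub (integrable_charFun_mul_conj _ _ _)
  · exact (integrable_charFun_mul_conj _ _ _).sub (integrable_charFun_mul_conj _ _ _)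

end FeatureMap

/-! ### The SIGReg regularizer as a spectral integral -/

instance isProbabilityMeasure_isotropicGaussian (d : ℕ) (σ : ℝ) :
    IsProbabilityMeasure (isotropicGaussian d σ) := by
  unfold isotropicGaussian
  infer_instance

lemma charFun_projection {d : ℕ} (θ : E d) (P : Measure (E d)) (ω : ℝ) :
    charFun (projection θ P) ω = charFun P (ω • θ) := by
  rw [projection, charFun_apply_real, charFun_apply, integral_map (by fun_prop)
    (Continuous.aestronglyMeasurable (by fun_prop))]
  refine integral_congr_ae (ae_of_all _ fun x => ?_)
  simp only [inner_smul_right, real_inner_comm x]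
  push_cast
  rfl

/-- This is why one fixed target `N(0, σ²)` can be compared with the projections in all directions.
-/
lemma charFun_isotropicGaussian_smul {d : ℕ} (σ : ℝ) (θ : E d) (hθ : ‖θ‖ = 1) (ω : ℝ) :
    charFun (isotropicGaussian d σ) (ω • θ) = charFun (gaussianReal 0 (σ ^ 2).toNNReal) ω := by
  have hS : (σ ^ 2 • (1 : Matrix (Fin d) (Fin d) ℝ)).PosSemidef :=
    Matrix.PosSemidef.one.smul (sq_nonneg σ)
  rw [isotropicGaussian, charFun_multivariateGaussian hS, charFun_gaussianReal,
    Real.coe_toNNReal _ (sq_nonneg σ)]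
  have h : (θ.ofLp ⬝ᵥ θ.ofLp : ℝ) = 1 := by
    have := EuclideanSpace.real_norm_sq_eq θ
    rw [hθ] at this
    simp only [dotProduct, ← sq]
    linarith
  have h2 : ((ω • θ).ofLp ⬝ᵥ ((σ ^ 2 • (1 : Matrix (Fin d) (Fin d) ℝ)).mulVec (ω • θ).ofLp) : ℝ) =
      σ ^ 2 * ω ^ 2 := by
    rw [Matrix.smul_mulVec, Matrix.one_mulVec, WithLp.ofLp_smul, smul_dotProduct, dotProduct_smul,
      dotProduct_smul, h]
    simp only [smul_eq_mul]
    ring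
  rw [h2, inner_zero_right]
  simp

lemma eppsPulleyIntegrand_projection {d : ℕ} {γ : ℝ} (hγ : 0 < γ) (σ : ℝ) (P : Measure (E d))
    (θ : Metric.sphere (0 : E d) 1) (ω : ℝ) :
    eppsPulleyIntegrand γ σ (projection (θ : E d) P) ω =
      gaussianPDFReal 0 (2 * γ).toNNReal ω •
        ‖charFun P (ω • (θ : E d)) - charFun (isotropicGaussian d σ) (ω • (θ : E d))‖ ^ 2 := by
  rw [eppsPulleyIntegrand, charFun_projection,
    charFun_isotropicGaussian_smul σ (θ : E d) (norm_eq_of_mem_sphere θ) ω,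
    gaussianPDFReal_eq_gaussianSpectralDensity hγ, smul_eq_mul, mul_comm]

lemma norm_sq_charFun_sub_charFun_le {d : ℕ} (P Q : Measure (E d)) [IsProbabilityMeasure P]
    [IsProbabilityMeasure Q] (v : E d) : ‖‖charFun P v - charFun Q v‖ ^ 2‖ ≤ 2 ^ 2 := by
  rw [norm_pow, norm_norm]
  gcongr
  exact (norm_sub_le _ _).trans (by
    linarith [norm_charFun_le_one (μ := P) v, norm_charFun_le_one (μ := Q) v])

lemma measurable_norm_sq_charFun_sub_charFun {d : ℕ} (P Q : Measure (E d))
    [IsProbabilityMeasure P] [IsProbabilityMeasure Q] :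
    Measurable fun v : E d => ‖charFun P v - charFun Q v‖ ^ 2 :=
  (measurable_charFun.sub measurable_charFun).norm.pow_const 2

lemma integrable_eppsPulleyIntegrand {γ : ℝ} (hγ : 0 < γ) (σ : ℝ) (P : Measure ℝ)
    [IsProbabilityMeasure P] : Integrable (eppsPulleyIntegrand γ σ P) := by
  unfold eppsPulleyIntegrand
  simp_rw [← gaussianPDFReal_eq_gaussianSpectralDensity hγ]
  refine (integrable_gaussianPDFReal _ _).bdd_mul (c := 2 ^ 2)
    ((measurable_charFun.sub measurable_charFun).norm.pow_const 2).aestronglyMeasurable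
    (ae_of_all _ fun v => ?_)
  rw [norm_pow, norm_norm]
  gcongr
  exact (norm_sub_le _ _).trans (by
    linarith [norm_charFun_le_one (μ := P) v,
      norm_charFun_le_one (μ := gaussianReal 0 (σ ^ 2).toNNReal) v])

/-- The factor `n` cancels and the weight `ρ` becomes the measure `N(0, 2γ)`, the radial part of the
spectral measure. -/
lemma inv_mul_eppsPulley_projection {d n : ℕ} (hn : 1 ≤ n) {γ : ℝ} (hγ : 0 < γ) (σ : ℝ)
    (P : Measure (E d)) (θ : Metric.sphere (0 : E d) 1) :
    (n : ℝ)⁻¹ * eppsPulley γ σ n (projection (θ : E d) P) =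
      ∫ ω, ‖charFun P (ω • (θ : E d)) - charFun (isotropicGaussian d σ) (ω • (θ : E d))‖ ^ 2
        ∂(gaussianReal 0 (2 * γ).toNNReal) := by
  have hv : (2 * γ).toNNReal ≠ 0 := by simpa using hγ
  rw [eppsPulley, inv_mul_cancel_left₀ (by positivity),
    integral_gaussianReal_eq_integral_smul hv]
  exact integral_congr_ae (ae_of_all _ fun ω => eppsPulleyIntegrand_projection hγ σ P θ ω)

lemma integrable_norm_sq_charFun_sub_charFun_smul {d : ℕ} [NeZero d] (γ : ℝ)
    (P Q : Measure (E d)) [IsProbabilityMeasure P] [IsProbabilityMeasure Q] :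
    Integrable (fun p : Metric.sphere (0 : E d) 1 × ℝ =>
      ‖charFun P (p.2 • (p.1 : E d)) - charFun Q (p.2 • (p.1 : E d))‖ ^ 2)
      ((uniformSphere d).prod (gaussianReal 0 (2 * γ).toNNReal)) :=
  Integrable.of_bound ((measurable_norm_sq_charFun_sub_charFun P Q).comp
    (measurable_smul_sphere d)).aestronglyMeasurable _
    (ae_of_all _ fun _ => norm_sq_charFun_sub_charFun_le P Q _)

lemma integrable_eppsPulley_projection {d n : ℕ} (hd : 1 ≤ d) (hn : 1 ≤ n) {γ : ℝ} (hγ : 0 < γ)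
    (σ : ℝ) (P : Measure (E d)) [IsProbabilityMeasure P] :
    Integrable (fun θ : Metric.sphere (0 : E d) 1 =>
      (n : ℝ)⁻¹ * eppsPulley γ σ n (projection (θ : E d) P)) (uniformSphere d) := by
  have : NeZero d := ⟨by omega⟩
  simp_rw [inv_mul_eppsPulley_projection hn hγ]
  exact (integrable_norm_sq_charFun_sub_charFun_smul γ P _).integral_prod_left

theorem sigReg_eq_integral_spectralMeasure {d n : ℕ} (hd : 1 ≤ d) (hn : 1 ≤ n) {γ : ℝ}
    (hγ : 0 < γ) (σ : ℝ) (P : Measure (E d)) [IsProbabilityMeasure P] :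
    sigReg d γ σ n P =
      ∫ v, ‖charFun P v - charFun (isotropicGaussian d σ) v‖ ^ 2 ∂(spectralMeasure d γ) := by
  have : NeZero d := ⟨by omega⟩
  rw [sigReg, spectralMeasure, integral_map (measurable_smul_sphere d).aemeasurable
    (measurable_norm_sq_charFun_sub_charFun P _).aestronglyMeasurable,
    integral_prod _ (integrable_norm_sq_charFun_sub_charFun_smul γ P _)]
  simp_rw [inv_mul_eppsPulley_projection hn hγ]

/-! ### Asymptotics of the Kummer function -/

lemma integrableOn_rpow_mul_one_sub_rpow {a c : ℝ} (ha : 0 < a) (hc : 0 < c) :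
    IntegrableOn (fun s : ℝ => s ^ (a - 1) * (1 - s) ^ (c - 1)) (Set.Ioo 0 1) := by
  have h := Complex.betaIntegral_convergent (u := a) (v := c) (by simpa) (by simpa)
  rw [intervalIntegrable_iff_integrableOn_Ioo_of_le zero_le_one] at h
  refine h.re.congr ?_
  filter_upwards [ae_restrict_mem measurableSet_Ioo] with s hs
  norm_cast
  rw [← Complex.ofReal_cpow hs.1.le, ← Complex.ofReal_cpow (sub_nonneg.2 hs.2.le),
    ← Complex.ofReal_mul, RCLike.re_eq_complex_re, Complex.ofReal_re]

lemma integral_rpow_mul_one_sub_rpow {a c : ℝ} (ha : 0 < a) (hc : 0 < c) :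
    ∫ s in Set.Ioo (0 : ℝ) 1, s ^ (a - 1) * (1 - s) ^ (c - 1) = beta a c := by
  apply Complex.ofReal_injective
  rw [beta, ← integral_complex_ofReal]
  push_cast
  rw [← Complex.Gamma_ofReal, ← Complex.Gamma_ofReal, ← Complex.Gamma_ofReal, Complex.ofReal_add,
    ← Complex.betaIntegral_eq_Gamma_mul_div _ _ (by simpa) (by simpa), Complex.betaIntegral,
    intervalIntegral.integral_of_le zero_le_one, integral_Ioc_eq_integral_Ioo]
  refine setIntegral_congr_fun measurableSet_Ioo fun s hs => ?_
  rw [Complex.ofReal_cpow hs.1.le, Complex.ofReal_cpow (sub_nonneg.2 hs.2.le)]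
  push_cast
  rfl

/-- Euler's integral representation of the Kummer function. -/
theorem integral_eq_beta_mul_kummer {a b : ℝ} (ha : 0 < a) (hab : a < b) (z : ℝ) :
    ∫ s in Set.Ioo (0 : ℝ) 1, s ^ (a - 1) * (1 - s) ^ (b - a - 1) * Real.exp (z * s) =
      beta a (b - a) * kummer a b z := by
  have hc : 0 < b - a := sub_pos.2 hab
  have hb : 0 < b := ha.trans hab
  have hw := integrableOn_rpow_mul_one_sub_rpow ha hc
  have hmem := ae_restrict_mem (μ := volume) (measurableSet_Ioo (a := (0 : ℝ)) (b := 1))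
  have h := hasSum_integral_of_dominated_convergence (μ := volume.restrict (Set.Ioo (0 : ℝ) 1))
    (F := fun (m : ℕ) s => s ^ (a - 1) * (1 - s) ^ (b - a - 1) * ((z * s) ^ m / m.factorial))
    (f := fun s => s ^ (a - 1) * (1 - s) ^ (b - a - 1) * Real.exp (z * s))
    (fun m s => s ^ (a - 1) * (1 - s) ^ (b - a - 1) * (|z| ^ m / m.factorial))
    (fun m => (Measurable.aestronglyMeasurable (by fun_prop)))
    (fun m => by
      filter_upwards [hmem] with s hs
      have h1 : 0 ≤ s ^ (a - 1) * (1 - s) ^ (b - a - 1) :=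
        mul_nonneg (Real.rpow_nonneg hs.1.le _) (Real.rpow_nonneg (sub_nonneg.2 hs.2.le) _)
      rw [norm_mul, Real.norm_of_nonneg h1, norm_div, norm_pow, Real.norm_natCast,
        Real.norm_eq_abs, abs_mul, abs_of_pos hs.1]
      have : |z| * s ≤ |z| := mul_le_of_le_one_right (abs_nonneg z) hs.2.le
      have : 0 ≤ |z| * s := mul_nonneg (abs_nonneg z) hs.1.le
      gcongr)
    (ae_of_all _ fun s => (Real.summable_pow_div_factorial _).mul_left _)
    (by simp only [tsum_mul_left]; exact hw.mul_const _)
    (ae_of_all _ fun s => by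
      have := NormedSpace.expSeries_div_hasSum_exp (z * s)
      rw [← Real.exp_eq_exp_ℝ] at this
      exact this.mul_left _)
  rw [← h.tsum_eq, kummer, ← tsum_mul_left]
  refine tsum_congr fun m => ?_
  have hm : ∫ s in Set.Ioo (0 : ℝ) 1,
      s ^ (a - 1) * (1 - s) ^ (b - a - 1) * ((z * s) ^ m / m.factorial) =
      beta (a + m) (b - a) * (z ^ m / m.factorial) := by
    rw [← integral_rpow_mul_one_sub_rpow (by positivity) hc, ← integral_mul_const]
    refine setIntegral_congr_fun measurableSet_Ioo fun s hs => ?_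
    -- The factor `s ^ m` shifts the first Beta parameter from `a` to `a + m`.
    rw [add_sub_right_comm, Real.rpow_add_natCast hs.1.ne']
    ring
  have hP := ascPochhammer_pos m _ hb
  have hG := Real.Gamma_pos_of_pos hb
  rw [hm, beta, beta, add_right_comm, add_sub_cancel, Gamma_add_natCast ha, Gamma_add_natCast hb]
  field_simp

/-- An Abelian theorem for the Laplace transform. -/
lemma tendsto_rpow_mul_integral_rpow_mul_exp {a : ℝ} (ha : 0 < a) {h : ℝ → ℝ}
    (hm : Measurable h) {C : ℝ} (hC : ∀ s, |h s| ≤ C) {l : ℝ} (hl : Tendsto h (𝓝[>] 0) (𝓝 l)) :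
    Tendsto (fun t : ℝ => t ^ a * ∫ s in Set.Ioi (0 : ℝ), s ^ (a - 1) * h s * Real.exp (-t * s))
      atTop (𝓝 (Real.Gamma a * l)) := by
  -- Rescaling `s` to `s / t` absorbs `t ^ a`; then `h (s / t) → l` under the Gamma weight.
  have h1 : Tendsto (fun t : ℝ => ∫ s in Set.Ioi (0 : ℝ),
      Real.exp (-s) * s ^ (a - 1) * h (t⁻¹ * s)) atTop (𝓝 (Real.Gamma a * l)) := by
    rw [Real.Gamma_eq_integral ha, ← integral_mul_const]
    refine tendsto_integral_filter_of_dominated_convergence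
      (fun s => Real.exp (-s) * s ^ (a - 1) * C)
      (.of_forall fun t => (Measurable.aestronglyMeasurable (by fun_prop)))
      (.of_forall fun t => ?_) ((Real.GammaIntegral_convergent ha).mul_const C) ?_
    · filter_upwards [ae_restrict_mem measurableSet_Ioi] with s hs
      have : 0 < s := hs
      rw [norm_mul, Real.norm_of_nonneg (by positivity)]
      gcongr
      exact hC _
    · filter_upwards [ae_restrict_mem measurableSet_Ioi] with s hs
      refine (hl.comp (tendsto_nhdsWithin_iff.2 ⟨?_, ?_⟩)).const_mul _
      · simpa using tendsto_inv_atTop_zero.mul_const s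
      · filter_upwards [eventually_gt_atTop 0] with t ht
        exact mul_pos (inv_pos.2 ht) hs
  refine h1.congr' ?_
  filter_upwards [eventually_gt_atTop 0] with t ht
  have h2 := integral_comp_mul_left_Ioi
    (fun s => Real.exp (-s) * s ^ (a - 1) * h (t⁻¹ * s)) 0 ht
  rw [mul_zero, smul_eq_mul] at h2
  rw [← mul_inv_cancel_left₀ ht.ne' (∫ s in Set.Ioi (0 : ℝ), _), ← h2, ← integral_const_mul,
    ← integral_const_mul]
  refine setIntegral_congr_fun measurableSet_Ioi fun s hs => ?_
  rw [inv_mul_cancel_left₀ ht.ne', Real.mul_rpow ht.le (le_of_lt hs), Real.rpow_sub_one ht.ne',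
    neg_mul]
  field_simp

/-- The tail of the Kummer function at `-∞`. -/
theorem tendsto_rpow_mul_kummer_neg {a b : ℝ} (ha : 0 < a) (hab : a < b) :
    Tendsto (fun t : ℝ => t ^ a * kummer a b (-t)) atTop
      (𝓝 (Real.Gamma b / Real.Gamma (b - a))) := by
  have hc : 0 < b - a := sub_pos.2 hab
  set w : ℝ → ℝ := fun s => s ^ (a - 1) * (1 - s) ^ (b - a - 1) with hw
  have hwi : IntegrableOn w (Set.Ioo 0 1) := integrableOn_rpow_mul_one_sub_rpow ha hc
  -- The cutoff at `1/2` keeps `h` bounded: for `b - a < 1` the factor `(1 - s) ^ (b - a - 1)` blows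
  -- up at `s = 1`.
  set h : ℝ → ℝ := (Set.Ioo (0 : ℝ) (1 / 2)).indicator fun s => (1 - s) ^ (b - a - 1) with hh
  have hnear : Tendsto (fun t : ℝ => t ^ a * ∫ s in Set.Ioo (0 : ℝ) (1 / 2),
      w s * Real.exp (-t * s)) atTop (𝓝 (Real.Gamma a * 1)) := by
    have := tendsto_rpow_mul_integral_rpow_mul_exp (h := h) ha
      -- On the cutoff interval the power is at most `1` or `(1/2) ^ (b - a - 1)`, according to the
      -- sign of the exponent; the sum covers both cases.
      (Measurable.indicator (by fun_prop) measurableSet_Ioo) (C := 1 + (1 / 2) ^ (b - a - 1)) ?_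
      (l := 1) ?_
    · refine this.congr fun t => ?_
      have hind (s : ℝ) : s ^ (a - 1) * h s * Real.exp (-t * s) =
          (Set.Ioo (0 : ℝ) (1 / 2)).indicator (fun s => w s * Real.exp (-t * s)) s := by
        by_cases hs : s ∈ Set.Ioo (0 : ℝ) (1 / 2)
        · simp only [hh, hw, Set.indicator_of_mem hs]
        · simp only [hh, Set.indicator_of_notMem hs, mul_zero, zero_mul]
      simp_rw [hind]
      rw [setIntegral_indicator measurableSet_Ioo, Set.inter_eq_right.2 Set.Ioo_subset_Ioi_self]
    · intro s
      by_cases hs : s ∈ Set.Ioo (0 : ℝ) (1 / 2)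
      · have h1 : (1 / 2 : ℝ) ≤ 1 - s := by linarith [hs.2]
        have h2 : 1 - s ≤ 1 := by linarith [hs.1]
        have h3 : (0 : ℝ) ≤ (1 / 2) ^ (b - a - 1) := by positivity
        simp only [hh, Set.indicator_of_mem hs]
        rw [abs_of_nonneg (Real.rpow_nonneg (by linarith) _)]
        rcases le_total 0 (b - a - 1) with h0 | h0
        · linarith [Real.rpow_le_one (by linarith) h2 h0]
        · linarith [Real.rpow_le_rpow_of_nonpos (by norm_num) h1 h0]
      · simp only [hh, Set.indicator_of_notMem hs, abs_zero]
        positivity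
    · have hcont : ContinuousAt (fun s : ℝ => (1 - s) ^ (b - a - 1)) 0 :=
        ContinuousAt.rpow_const (by fun_prop) (Or.inl (by norm_num))
      have := hcont.tendsto.mono_left (nhdsWithin_le_nhds (s := Set.Ioi 0))
      simp only [sub_zero, Real.one_rpow] at this
      refine this.congr' ?_
      filter_upwards [Ioo_mem_nhdsGT (show (0 : ℝ) < 1 / 2 by norm_num)] with s hs
      simp only [hh, Set.indicator_of_mem hs]
  -- Here `exp (-t s) ≤ exp (-t / 2)`, which beats `t ^ a`, while the singular weight stays
  -- integrable.
  have hfar : Tendsto (fun t : ℝ => t ^ a * ∫ s in Set.Ico (1 / 2 : ℝ) 1,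
      w s * Real.exp (-t * s)) atTop (𝓝 0) := by
    have hsub : Set.Ico (1 / 2 : ℝ) 1 ⊆ Set.Ioo 0 1 := fun s hs =>
      ⟨lt_of_lt_of_le (by norm_num) hs.1, hs.2⟩
    have hlim := (tendsto_rpow_mul_exp_neg_mul_atTop_nhds_zero a (1 / 2) one_half_pos).mul_const
      (∫ s in Set.Ico (1 / 2 : ℝ) 1, w s)
    rw [zero_mul] at hlim
    refine squeeze_zero' ?_ ?_ hlim
    · filter_upwards [eventually_ge_atTop 0] with t ht
      refine mul_nonneg (Real.rpow_nonneg ht _) (setIntegral_nonneg measurableSet_Ico fun s hs => ?_)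
      have := hsub hs
      exact mul_nonneg (mul_nonneg (Real.rpow_nonneg this.1.le _)
        (Real.rpow_nonneg (sub_nonneg.2 this.2.le) _)) (Real.exp_nonneg _)
    · filter_upwards [eventually_ge_atTop 0] with t ht
      rw [mul_assoc, ← integral_const_mul (Real.exp _)]
      refine mul_le_mul_of_nonneg_left ?_ (Real.rpow_nonneg ht _)
      refine integral_mono_of_nonneg ?_ ((hwi.mono_set hsub).const_mul _) ?_
      · filter_upwards [ae_restrict_mem measurableSet_Ico] with s hs
        have := hsub hs
        exact mul_nonneg (mul_nonneg (Real.rpow_nonneg this.1.le _)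
          (Real.rpow_nonneg (sub_nonneg.2 this.2.le) _)) (Real.exp_nonneg _)
      · filter_upwards [ae_restrict_mem measurableSet_Ico] with s hs
        have := hsub hs
        rw [mul_comm]
        refine mul_le_mul_of_nonneg_right (Real.exp_le_exp.2 ?_)
          (mul_nonneg (Real.rpow_nonneg this.1.le _) (Real.rpow_nonneg (sub_nonneg.2 this.2.le) _))
        nlinarith [hs.1]
  have hsum := (hnear.add hfar).div_const (beta a (b - a))
  have hGa := Real.Gamma_pos_of_pos ha
  have hGc := Real.Gamma_pos_of_pos hc
  have hlim : (Real.Gamma a * 1 + 0) / beta a (b - a) = Real.Gamma b / Real.Gamma (b - a) := by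
    rw [beta, add_sub_cancel]
    field_simp
    simp
  rw [hlim] at hsum
  refine hsum.congr' ?_
  filter_upwards [eventually_ge_atTop 0] with t ht
  have hi : IntegrableOn (fun s => w s * Real.exp (-t * s)) (Set.Ioo 0 1) := by
    refine Integrable.mul_bdd (c := 1) hwi (Continuous.aestronglyMeasurable (by fun_prop)) ?_
    filter_upwards [ae_restrict_mem measurableSet_Ioo] with s hs
    rw [Real.norm_of_nonneg (Real.exp_nonneg _), Real.exp_le_one_iff]
    nlinarith [hs.1]
  have hun : Set.Ioo (0 : ℝ) 1 = Set.Ioo 0 (1 / 2) ∪ Set.Ico (1 / 2) 1 :=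
    (Set.Ioo_union_Ico_eq_Ioo (by norm_num) (by norm_num)).symm
  rw [← mul_add, ← setIntegral_union (by
      rw [Set.disjoint_left]; exact fun s hs hs' => hs.2.not_ge hs'.1) measurableSet_Ico
      (hi.mono_set (hun ▸ Set.subset_union_left)) (hi.mono_set (hun ▸ Set.subset_union_right)),
    ← hun, integral_eq_beta_mul_kummer ha hab]
  have := (beta_pos ha hc).ne'
  field_simp

/-! ### Tails of the kernels -/

lemma isEquivalent_kummer_neg_mul_sq {d : ℕ} (hd : 2 ≤ d) {γ : ℝ} (hγ : 0 < γ) :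
    (fun r : ℝ => kummer (1 / 2) ((d : ℝ) / 2) (-γ * r ^ 2)) ~[atTop]
      fun r => Real.Gamma ((d : ℝ) / 2) / (Real.Gamma (((d : ℝ) - 1) / 2) * √γ) * r⁻¹ := by
  have hd' : (2 : ℝ) ≤ d := by exact_mod_cast hd
  have hG : 0 < Real.Gamma ((d : ℝ) / 2) := Real.Gamma_pos_of_pos (by linarith)
  have hG1 : 0 < Real.Gamma (((d : ℝ) - 1) / 2) := Real.Gamma_pos_of_pos (by linarith)
  have hs : 0 < √γ := Real.sqrt_pos.2 hγ
  have h := (tendsto_rpow_mul_kummer_neg (a := 1 / 2) (b := (d : ℝ) / 2) one_half_pos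
    (by linarith)).comp ((tendsto_pow_atTop (two_ne_zero)).const_mul_atTop hγ)
  rw [← sub_div] at h
  have hne : ∀ᶠ r : ℝ in atTop,
      Real.Gamma ((d : ℝ) / 2) / (Real.Gamma (((d : ℝ) - 1) / 2) * √γ) * r⁻¹ ≠ 0 := by
    filter_upwards [eventually_gt_atTop 0] with r hr
    positivity
  rw [isEquivalent_iff_tendsto_one hne]
  have h1 := h.div_const (Real.Gamma ((d : ℝ) / 2) / Real.Gamma (((d : ℝ) - 1) / 2))
  rw [div_self (by positivity)] at h1
  refine h1.congr' ?_
  filter_upwards [eventually_gt_atTop 0] with r hr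
  simp only [Function.comp_apply, Pi.div_apply]
  rw [← Real.sqrt_eq_rpow, Real.sqrt_mul hγ.le, Real.sqrt_sq hr.le, ← neg_mul]
  field_simp

lemma isLittleO_exp_neg_kummer_neg_mul_sq {d : ℕ} (hd : 2 ≤ d) {γ : ℝ} (hγ : 0 < γ) {c : ℝ}
    (hc : 0 < c) :
    (fun r : ℝ => Real.exp (-c * r)) =o[atTop]
      fun r => kummer (1 / 2) ((d : ℝ) / 2) (-γ * r ^ 2) := by
  have hd' : (2 : ℝ) ≤ d := by exact_mod_cast hd
  have hG : 0 < Real.Gamma ((d : ℝ) / 2) := Real.Gamma_pos_of_pos (by linarith)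
  have hG1 : 0 < Real.Gamma (((d : ℝ) - 1) / 2) := Real.Gamma_pos_of_pos (by linarith)
  have hs : 0 < √γ := Real.sqrt_pos.2 hγ
  refine IsLittleO.trans_isEquivalent ?_ (isEquivalent_kummer_neg_mul_sq hd hγ).symm
  refine IsLittleO.const_mul_right (by positivity) ?_
  refine (isLittleO_iff_tendsto' ?_).2 ?_
  · filter_upwards [eventually_gt_atTop 0] with r hr h
    exact absurd h (by positivity)
  · have := tendsto_rpow_mul_exp_neg_mul_atTop_nhds_zero 1 c hc
    refine this.congr fun r => ?_
    rw [Real.rpow_one, div_inv_eq_mul, mul_comm]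

lemma isLittleO_exp_neg_mul_sq_exp_neg_mul {γ : ℝ} (hγ : 0 < γ) (c : ℝ) :
    (fun r : ℝ => Real.exp (-γ * r ^ 2)) =o[atTop] fun r => Real.exp (-c * r) := by
  rw [Real.isLittleO_exp_comp_exp_comp]
  have h : Tendsto (fun r : ℝ => r * (γ * r - c)) atTop atTop :=
    tendsto_id.atTop_mul_atTop₀
      (tendsto_atTop_add_const_right _ (-c) (tendsto_id.const_mul_atTop hγ))
  exact h.congr fun r => by ring

end KerJEPA

open KerJEPA in
theorem mainTheorem1 (d n : ℕ) (hd : 1 ≤ d) (hn : 1 ≤ n) (γ σ : ℝ) (hγ : 0 < γ) (hσ : 0 < σ) :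
    -- the kernel is positive definite, so it has a reproducing kernel Hilbert space
    (KerJEPA.scalarKernel (KerJEPA.kummerKernel d γ)).PosSemidef ∧
    -- SIGReg is the squared MMD to the isotropic Gaussian; all expectations are well defined
    (∀ (P : Measure (KerJEPA.E d)) [IsProbabilityMeasure P],
      (∀ θ : Metric.sphere (0 : KerJEPA.E d) 1, Integrable
        (KerJEPA.eppsPulleyIntegrand γ σ (KerJEPA.projection (θ : KerJEPA.E d) P))) ∧
      Integrable (fun θ : Metric.sphere (0 : KerJEPA.E d) 1 =>
        (n : ℝ)⁻¹ * KerJEPA.eppsPulley γ σ n (KerJEPA.projection (θ : KerJEPA.E d) P))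
        (KerJEPA.uniformSphere d) ∧
      ∀ (H : Type*) [NormedAddCommGroup H] [InnerProductSpace ℝ H] [CompleteSpace H]
        [RKHS ℝ H (KerJEPA.E d) ℝ],
        RKHS.kernel H = KerJEPA.scalarKernel (KerJEPA.kummerKernel d γ) →
          Integrable (KerJEPA.featureMap H) P ∧
          Integrable (KerJEPA.featureMap H) (KerJEPA.isotropicGaussian d σ) ∧
          KerJEPA.sigReg d γ σ n P =
            KerJEPA.mmd H P (KerJEPA.isotropicGaussian d σ) ^ 2) ∧
    -- the tails are polynomial, of order `‖x - y‖⁻¹`, unlike those of the Gaussian kernel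
    (2 ≤ d →
      ((fun p : KerJEPA.E d × KerJEPA.E d => KerJEPA.kummerKernel d γ p.1 p.2)
        ~[KerJEPA.farApart d]
        fun p => Real.Gamma ((d : ℝ) / 2) / (Real.Gamma (((d : ℝ) - 1) / 2) * Real.sqrt γ) *
          ‖p.1 - p.2‖⁻¹) ∧
      ∀ c : ℝ, 0 < c →
        ((fun p : KerJEPA.E d × KerJEPA.E d => KerJEPA.gaussianKernel d γ p.1 p.2)
          =o[KerJEPA.farApart d] fun p => Real.exp (-c * ‖p.1 - p.2‖)) ∧
        ((fun p : KerJEPA.E d × KerJEPA.E d => Real.exp (-c * ‖p.1 - p.2‖))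
          =o[KerJEPA.farApart d] fun p => KerJEPA.kummerKernel d γ p.1 p.2)) := by
  -- Both kernels depend only on `‖x - y‖`, so one-variable asymptotics pull back along this map.
  have hfar : Tendsto (fun p : E d × E d => ‖p.1 - p.2‖) (farApart d) atTop := tendsto_comap
  refine ⟨posSemidef_scalarKernel_kummerKernel hd hγ, fun P _ => ⟨fun θ => ?_,
    integrable_eppsPulley_projection hd hn hγ σ P, fun H _ _ _ _ hH =>
      ⟨integrable_featureMap hd hγ hH P, integrable_featureMap hd hγ hH _, ?_⟩⟩,
    fun h2 => ⟨(isEquivalent_kummer_neg_mul_sq h2 hγ).comp_tendsto hfar, fun c hc =>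
      ⟨(isLittleO_exp_neg_mul_sq_exp_neg_mul hγ c).comp_tendsto hfar,
        (isLittleO_exp_neg_kummer_neg_mul_sq h2 hγ hc).comp_tendsto hfar⟩⟩⟩
  · have : IsProbabilityMeasure (projection (θ : E d) P) :=
      Measure.isProbabilityMeasure_map (by fun_prop)
    exact integrable_eppsPulleyIntegrand hγ σ _
  · rw [sigReg_eq_integral_spectralMeasure hd hn hγ, mmd_sq_eq_integral_spectralMeasure hd hγ hH]
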